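/- Let $X$ be a perfectly normal topological space (that is, $X$ is $T_1$ and normal, and every closed subset of $X$ is a $G_\delta$ set). Write $\omega=\{0,1,2,\dots\}$ and use the following notions. - $X$ is a QN-space if for every sequence $(f_n)_{n\in\omega}$ of continuous functions $f_n:X\to\mathbb R$ converging pointwise to $0$ there are positive reals $\varepsilon_n\to 0$ such that for every $x\in X$ we have $|f_n(x)|<\varepsilon_n$ for all but finitely many $n$. - A set $Y\subseteq{}^{\omega}R$, where $R$ is $\mathbb R$ or $\omega$, is eventually bounded if there is $\beta\in{}^{\omega}R$ such that for every $\alpha\in Y$ we have $\alpha(n)\le\beta(n)$ for all but finitely many $n$. - A $\gamma$-cover of $X$ is an infinite family $\mathcal U$ of subsets of $X$ with $\bigcup\mathcal U=X$ and $X\notin\mathcal U$ such that for every $x\in X$ the set $\{U\in\mathcal U: x\notin U\}$ is finite. $\Gamma(\mathrm{Borel})$ is the family of all $\gamma$-covers of $X$ (of any cardinality) consisting of Borel sets. - $X$ is a $U_{fin}(\Gamma(\mathrm{Borel}),\Gamma(\mathrm{Borel}))$-space if for every sequence $(\mathcal U_n)_{n\in\omega}$ in $\Gamma(\mathrm{Borel})$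 there are finite sets $\mathcal V_n\subseteq\mathcal U_n$ such that $\{\bigcup\mathcal V_n:n\in\omega\}\in\Gamma(\mathrm{Borel})$ or $\bigcup\mathcal V_n=X$ for some $n$. - A set $F$ of functions $X\to\mathbb R$ has the property $(\Gamma_0)$ if $F$ is infinite, the zero function is not in $F$, and for every $x\in X$ and $\varepsilon>0$ the set $\{f\in F:|f(x)|\ge\varepsilon\}$ is finite. - The set of all Borel measurable functions $X\to\mathbb R$ satisfies the selection principle $U^*_{fin}(\Gamma_0,\Gamma_0)$ if for every sequence $(F_n)_{n\in\omega}$ of sets of Borel measurable functions $X\to\mathbb R$, each with the property $(\Gamma_0)$, there are finite sets $H_n\subseteq F_n$ such that $\{\min H_n:n\in\omega\}$ is a set of Borel measurable functions with the property $(\Gamma_0)$. Here $\min H$ denotes the pointwise minimum, and $\min\emptyset$ is the constant function $1$. Then the following are equivalent: 1. $X$ is a QN-space; 2. for every Borel measurable $f:X\to{}^{\omega}\mathbb R$ the image $f(X)$ is eventually bounded; 3. for every Borel measurable $f:X\to{}^{\omega}\omega$ the image $f(X)$ is eventually bounded; 4. the set of all Borel measurable functions $X\to\mathbb R$ satisfies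 the selection principle $U^*_{fin}(\Gamma_0,\Gamma_0)$; 5. $X$ is a $U_{fin}(\Gamma(\mathrm{Borel}),\Gamma(\mathrm{Borel}))$-space. -/

import Mathlib

open Filter Topology

noncomputable section

namespace SelectionPrinciples

variable {X : Type*}

/-- Quasinormal convergence of a sequence of real functions to `f`: there is a control sequence
of positive reals converging to `0` that eventually dominates `|f_n(x) - f(x)|` at every point. -/
def QuasinormalTendsto (f : ℕ → X → ℝ) (g : X → ℝ) : Prop :=
  ∃ ε : ℕ → ℝ, (∀ n, 0 < ε n) ∧ Tendsto ε atTop (𝓝 0) ∧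
    ∀ x, ∀ᶠ n in atTop, |f n x - g x| < ε n

/-- A QN-space: every sequence of continuous real functions that converges pointwise to `0`
converges to `0` quasinormally. -/
def IsQNSpace (X : Type*) [TopologicalSpace X] : Prop :=
  ∀ f : ℕ → X → ℝ, (∀ n, Continuous (f n)) →
    (∀ x, Tendsto (fun n => f n x) atTop (𝓝 0)) →
      QuasinormalTendsto f (fun _ => 0)

/-- A set of sequences is eventually bounded if a single sequence dominates each of its members
at all but finitely many indices. -/
def EventuallyBounded {R : Type*} [LE R] (Y : Set (ℕ → R)) : Prop :=
  ∃ β : ℕ → R, ∀ α ∈ Y, ∀ᶠ n in atTop, α n ≤ β n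

/-- A cover of `X`; the whole space is not allowed as a member. -/
def IsCover (𝒰 : Set (Set X)) : Prop :=
  ⋃₀ 𝒰 = Set.univ ∧ Set.univ ∉ 𝒰

/-- A γ-cover: an infinite cover such that every point lies in all but finitely many members. -/
def IsGammaCover (𝒰 : Set (Set X)) : Prop :=
  IsCover 𝒰 ∧ 𝒰.Infinite ∧ ∀ x, {U ∈ 𝒰 | x ∉ U}.Finite

/-- `Γ(𝒜)`: the γ-covers all of whose members belong to `𝒜`. -/
def gammaCovers (𝒜 : Set (Set X)) : Set (Set (Set X)) :=
  {𝒰 | IsGammaCover 𝒰 ∧ 𝒰 ⊆ 𝒜}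

/-- The covering property `U_fin(𝔸, 𝔹)`. -/
def Ufin (𝔸 𝔹 : Set (Set (Set X))) : Prop :=
  ∀ 𝒰 : ℕ → Set (Set X), (∀ n, 𝒰 n ∈ 𝔸) →
    ∃ 𝒱 : ℕ → Set (Set X), (∀ n, (𝒱 n).Finite ∧ 𝒱 n ⊆ 𝒰 n) ∧
      (Set.range (fun n => ⋃₀ 𝒱 n) ∈ 𝔹 ∨ ∃ n, ⋃₀ 𝒱 n = Set.univ)

/-- The property `(Γ₀)` of a set of real functions. -/
def HasGammaZero (F : Set (X → ℝ)) : Prop :=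
  (0 : X → ℝ) ∉ F ∧ F.Infinite ∧ ∀ x, ∀ ε : ℝ, 0 < ε → {f ∈ F | ε ≤ |f x|}.Finite

/-- `Γ₀(F)`: the subsets of `F` with the property `(Γ₀)`. -/
def gammaZero (F : Set (X → ℝ)) : Set (Set (X → ℝ)) :=
  {H | H ⊆ F ∧ HasGammaZero H}

open Classical in
/-- The pointwise minimum of a finite set of real functions, with `min ∅ = 1`. -/
def minFun (H : Finset (X → ℝ)) : X → ℝ := fun x =>
  if hH : H.Nonempty then H.inf' hH (fun h => h x) else 1

/-- The selection principle `U*_fin(𝔽, 𝔾)` for families of sets of real functions. -/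
def UfinStar (𝔽 𝔾 : Set (Set (X → ℝ))) : Prop :=
  ∀ F : ℕ → Set (X → ℝ), (∀ n, F n ∈ 𝔽) →
    ∃ H : ℕ → Finset (X → ℝ), (∀ n, (H n : Set (X → ℝ)) ⊆ F n) ∧
      Set.range (fun n => minFun (H n)) ∈ 𝔾

end SelectionPrinciples

end

/-! Everything passes through boundedness of Borel images in `ℕ → ℕ`. Given this, if each point lies
in almost all sets of each row of a measurable array, the moduli of this convergence are bounded by
one sequence (`exists_tails_of_eventuallyBounded`). Quasinormality and both selection principles
follow.

A QN-space has the same tails property for continuous functions bounded by 1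
(`IsQNSpace.exists_tails`). Applied to bump functions, it separates the nonzero values of continuous
functions from 0 (`IsQNSpace.exists_gap`). In a perfectly normal space closed sets are zero sets, so
the gap makes every Borel set an Fσ; closed approximations of the sets `{f x n = m}` then bound any
Borel `f`.

A selection principle yields a set, not a sequence, so it controls only infinitely many indices;
passing to partial sums (`eventuallyBounded_of_monotone`) makes this enough. -/

namespace SelectionPrinciples

open Set

variable {X : Type*}

/-! ### QN-spaces: Borel sets are Fσ and Borel images are bounded -/

section QN

variable [TopologicalSpace X]

/-- In a QN-space, sequences of bounded continuous functions converging pointwise to `0` are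
eventually small on simultaneous tails. -/
theorem IsQNSpace.exists_tails (hX : IsQNSpace X) (ψ : ℕ → ℕ → X → ℝ)
    (hc : ∀ n k, Continuous (ψ n k)) (hb : ∀ n k x, |ψ n k x| ≤ 1)
    (ht : ∀ n x, Tendsto (fun k => ψ n k x) atTop (𝓝 0)) :
    ∃ β : ℕ → ℕ, ∀ x, ∀ᶠ n in atTop, ∀ k, β n ≤ k → |ψ n k x| < 1 / 2 := by
  -- The array becomes one sequence through pairing. Dividing row `n` by `n + 1` makes late rows
  -- uniformly small, while each early row tends to 0.
  obtain ⟨ε, -, hε, hεx⟩ := hX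
    (fun m x => ψ m.unpair.1 m.unpair.2 x / ((m.unpair.1 : ℝ) + 1))
    (fun m => (hc _ _).div_const _) (by
      intro x
      rw [Metric.tendsto_nhds]
      intro δ hδ
      obtain ⟨N, hN⟩ := exists_nat_one_div_lt hδ
      have h1 : ∀ n, ∀ᶠ k in atTop, |ψ n k x| < δ := fun n => by
        simpa [Real.dist_eq] using Metric.tendsto_nhds.1 (ht n x) δ hδ
      have h2 : ∀ᶠ k in atTop, ∀ n ∈ Finset.range N, |ψ n k x| < δ :=
        (Filter.eventually_all_finset _).2 fun n _ => h1 n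
      obtain ⟨K, hK⟩ := eventually_atTop.1 h2
      have hfin : {m : ℕ | m.unpair.1 < N ∧ m.unpair.2 < K}.Finite := by
        refine (((Set.finite_lt_nat N).prod (Set.finite_lt_nat K)).preimage
          (f := Nat.unpair) (Nat.pairEquiv.symm.injective.injOn)).subset ?_
        rintro m ⟨h1, h2⟩
        exact ⟨h1, h2⟩
      have := hfin.compl_mem_cofinite
      rw [Nat.cofinite_eq_atTop] at this
      filter_upwards [this] with m hm
      have hpos : (0 : ℝ) < (m.unpair.1 : ℝ) + 1 := by positivity
      rw [Real.dist_eq, sub_zero, abs_div, abs_of_pos hpos, div_lt_iff₀ hpos]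
      by_cases hmN : m.unpair.1 < N
      · have hmK : K ≤ m.unpair.2 := by
          by_contra h
          exact hm ⟨hmN, not_le.1 h⟩
        have := hK _ hmK _ (Finset.mem_range.2 hmN)
        nlinarith [(Nat.cast_nonneg m.unpair.1 : (0 : ℝ) ≤ _)]
      · have h3 : (N : ℝ) ≤ m.unpair.1 := by exact_mod_cast not_lt.1 hmN
        rw [div_lt_iff₀ (by positivity)] at hN
        have := hb m.unpair.1 m.unpair.2 x
        nlinarith)
  have hβ : ∀ n : ℕ, ∃ b, ∀ k, b ≤ k → ε (Nat.pair n k) < 1 / 2 / ((n : ℝ) + 1) := by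
    intro n
    have hp : Tendsto (fun k => Nat.pair n k) atTop atTop :=
      tendsto_atTop_mono (fun k => Nat.right_le_pair n k) tendsto_id
    exact eventually_atTop.1 ((hε.comp hp).eventually_lt_const (by positivity))
  choose β hβ using hβ
  refine ⟨β, fun x => ?_⟩
  obtain ⟨M, hM⟩ := eventually_atTop.1 (hεx x)
  filter_upwards [eventually_ge_atTop M] with n hn k hk
  have h1 := hM (Nat.pair n k) (hn.trans (Nat.left_le_pair n k))
  have h2 := h1.trans (hβ n k hk)
  have hpos : (0 : ℝ) < (n : ℝ) + 1 := by positivity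
  simp only [Nat.unpair_pair, sub_zero] at h2
  rwa [abs_div, abs_of_pos hpos, div_lt_div_iff_of_pos_right hpos] at h2

/-- In a QN-space, the nonzero values of a sequence of nonnegative continuous functions are
eventually bounded away from `0` at every point. -/
theorem IsQNSpace.exists_gap (hX : IsQNSpace X) (φ : ℕ → X → ℝ)
    (hc : ∀ n, Continuous (φ n)) (h0 : ∀ n x, 0 ≤ φ n x) :
    ∃ c : ℕ → ℝ, (∀ n, 0 < c n) ∧ ∀ x, ∀ᶠ n in atTop, φ n x = 0 ∨ c n ≤ φ n x := by
  obtain ⟨β, hβ⟩ := hX.exists_tails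
    -- The bump `2u / (1 + u²)` at `u = k φ` vanishes for `φ = 0` and tends to 0 as `k → ∞`
    -- otherwise, but is at least `4/5` for `u` in `[1, 2]`.
    (fun n k x => 2 * (k * φ n x) / (1 + (k * φ n x) ^ 2))
    (fun n k => by
      have := hc n
      refine Continuous.div (by fun_prop) (by fun_prop) fun x => by positivity)
    (fun n k x => by
      have := h0 n x
      rw [abs_of_nonneg (by positivity), div_le_one (by positivity)]
      nlinarith [sq_nonneg (k * φ n x - 1)])
    (fun n x => by
      rcases (h0 n x).eq_or_lt with h | h
      · simp [← h]
      · have hu : Tendsto (fun k : ℕ => (2 / φ n x) / (k : ℝ)) atTop (𝓝 0) :=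
          tendsto_const_div_atTop_nhds_zero_nat _
        refine squeeze_zero' (Eventually.of_forall fun k => by positivity) ?_ hu
        filter_upwards [eventually_gt_atTop 0] with k hk
        have hk' : (0 : ℝ) < k := by exact_mod_cast hk
        rw [div_div, div_le_div_iff₀ (by positivity) (by positivity)]
        nlinarith)
  refine ⟨fun n => 1 / ((β n : ℝ) + 1), fun n => by positivity, fun x => ?_⟩
  filter_upwards [hβ x] with n hn
  by_contra! hcon
  obtain ⟨hne, hlt⟩ := hcon
  have hpos : 0 < φ n x := (h0 n x).lt_of_ne' hne
  set t := φ n x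
  -- If `0 < t < 1 / (β n + 1)`, then `k = ⌈1 / t⌉` is past `β n` and `k t` lies in `[1, 2]`, where
  -- the bump exceeds `1/2`.
  have h1 : (β n : ℝ) + 1 < 1 / t := by
    rw [lt_div_iff₀ (by positivity)] at hlt ⊢
    linarith
  have hk1 : 1 / t ≤ (⌈1 / t⌉₊ : ℝ) := Nat.le_ceil _
  have hk2 : (⌈1 / t⌉₊ : ℝ) < 1 / t + 1 := Nat.ceil_lt_add_one (by positivity)
  have hkβ : β n ≤ ⌈1 / t⌉₊ := by
    have : (β n : ℝ) ≤ (⌈1 / t⌉₊ : ℝ) := by linarith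
    exact_mod_cast this
  have := hn _ hkβ
  generalize (⌈1 / t⌉₊ : ℝ) = k at *
  have ht1 : t ≤ 1 := by
    have : (1 : ℝ) < 1 / t := by linarith [(Nat.cast_nonneg (β n) : (0 : ℝ) ≤ _)]
    rw [lt_div_iff₀ hpos] at this
    linarith
  have hu1 : 1 ≤ k * t := by rwa [div_le_iff₀ hpos] at hk1
  have hu2 : k * t ≤ 2 := by
    have := mul_lt_mul_of_pos_right hk2 hpos
    rw [add_mul, div_mul_cancel₀ _ hpos.ne'] at this
    linarith
  rw [abs_of_nonneg (by positivity), div_lt_iff₀ (by positivity)] at this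
  nlinarith

theorem exists_continuous_zeroLocus [PerfectlyNormalSpace X] {s : Set X} (hs : IsClosed s) :
    ∃ φ : X → ℝ, Continuous φ ∧ (∀ x, 0 ≤ φ x) ∧ ∀ x, φ x = 0 ↔ x ∈ s := by
  obtain ⟨f, hf, -⟩ := perfectlyNormalSpace_iff_forall_isClosed_preimage_zero.1 ‹_› s hs
  refine ⟨fun x => |f x|, by fun_prop, fun x => abs_nonneg _, fun x => ?_⟩
  rw [hf]
  simp

/-- The complement is an increasing union of zero sets of functions `φ k`. With a gap `c`, a point
belongs to it exactly when `φ k x < c k` for infinitely many `k`, which is a Gδ condition. -/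
theorem IsQNSpace.isGδ_compl [PerfectlyNormalSpace X] (hX : IsQNSpace X) {s : Set X}
    (hs : IsGδ s) : IsGδ sᶜ := by
  obtain ⟨U, hU, rfl⟩ := isGδ_iff_eq_iInter_nat.1 hs
  have hF : ∀ k, IsClosed (⋃ i ∈ Finset.range (k + 1), (U i)ᶜ) := fun k =>
    isClosed_biUnion_finset fun i _ => (hU i).isClosed_compl
  choose φ hφc hφ0 hφ using fun k => exists_continuous_zeroLocus (hF k)
  obtain ⟨c, hc, hgap⟩ := hX.exists_gap φ hφc hφ0
  have : (⋂ n, U n)ᶜ = ⋂ N, ⋃ k, ⋃ (_ : N ≤ k), {x | φ k x < c k} := by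
    ext x
    simp only [mem_compl_iff, mem_iInter, mem_iUnion, mem_ofPred_eq, exists_prop, not_forall]
    constructor
    · rintro ⟨i, hi⟩ N
      refine ⟨max N i, le_max_left _ _, ?_⟩
      rw [(hφ (max N i) x).2 (mem_biUnion (by simp : i ∈ Finset.range (max N i + 1)) hi)]
      exact hc _
    · intro h
      obtain ⟨N, hN⟩ := eventually_atTop.1 (hgap x)
      obtain ⟨k, hk, hlt⟩ := h N
      have h0 := (hN k hk).resolve_right (not_le.2 hlt)
      obtain ⟨i, -, hi⟩ := mem_iUnion₂.1 ((hφ k x).1 h0)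
      exact ⟨i, hi⟩
  rw [this]
  exact IsGδ.iInter_of_isOpen fun N => isOpen_iUnion fun k => isOpen_iUnion fun _ =>
    isOpen_lt (hφc k) continuous_const

theorem IsQNSpace.isGδ_of_measurableSet [PerfectlyNormalSpace X] [MeasurableSpace X]
    [BorelSpace X] (hX : IsQNSpace X) {s : Set X} (hs : MeasurableSet s) : IsGδ s := by
  induction s, hs using MeasurableSet.induction_on_open with
  | isOpen U hU => exact hU.isGδ
  | compl s _ ih => exact hX.isGδ_compl ih
  | iUnion g _ _ ih =>
    rw [← compl_compl (⋃ i, g i), compl_iUnion]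
    exact hX.isGδ_compl (IsGδ.iInter fun i => hX.isGδ_compl (ih i))

/-- In a perfectly normal QN-space, closed `γ`-like covers satisfy a Hurewicz property. -/
theorem IsQNSpace.exists_closed_selection [PerfectlyNormalSpace X] (hX : IsQNSpace X)
    (C : ℕ → ℕ → Set X) (hC : ∀ n k, IsClosed (C n k))
    (hcov : ∀ n x, ∀ᶠ k in atTop, x ∈ C n k) :
    ∃ β : ℕ → ℕ, ∀ x, ∀ᶠ n in atTop, x ∈ C n (β n) := by
  choose φ hφc hφ0 hφ using fun n k => exists_continuous_zeroLocus (hC n k)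
  obtain ⟨c, hc, hgap⟩ := hX.exists_gap (fun m => φ m.unpair.1 m.unpair.2)
    (fun m => hφc _ _) (fun m => hφ0 _ _)
  -- By the gap, for large `n` this function equals 1 off `C n k`, so a value below `1/2` forces
  -- membership.
  obtain ⟨β, hβ⟩ := hX.exists_tails (fun n k x => min 1 (φ n k x / c (Nat.pair n k)))
    (fun n k => by
      have := hφc n k
      exact continuous_const.min (this.div_const _))
    (fun n k x => by
      rw [abs_of_nonneg (le_min zero_le_one (div_nonneg (hφ0 n k x) (hc _).le))]
      exact min_le_left _ _)
    (fun n x => by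
      refine tendsto_const_nhds.congr' ?_
      filter_upwards [hcov n x] with k hk
      simp [(hφ n k x).2 hk])
  refine ⟨β, fun x => ?_⟩
  obtain ⟨N, hN⟩ := eventually_atTop.1 (hgap x)
  filter_upwards [hβ x, eventually_ge_atTop N] with n hn hnN
  have h1 := hn _ le_rfl
  have h2 := hN (Nat.pair n (β n)) (hnN.trans (Nat.left_le_pair _ _))
  simp only [Nat.unpair_pair] at h2
  rcases h2 with h2 | h2
  · exact (hφ _ _ _).1 h2
  · rw [min_eq_left ((one_le_div (hc _)).2 h2)] at h1
    norm_num at h1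

theorem IsQNSpace.eventuallyBounded [PerfectlyNormalSpace X] [MeasurableSpace X]
    [BorelSpace X] (hX : IsQNSpace X) (f : X → ℕ → ℕ) (hf : Measurable f) :
    EventuallyBounded (range f) := by
  have hA : ∀ n m, ∃ D : ℕ → Set X, (∀ j, IsClosed (D j)) ∧ {x | f x n = m} = ⋃ j, D j := by
    intro n m
    have hm : MeasurableSet {x | f x n = m} :=
      ((measurable_pi_apply n).comp hf) (measurableSet_singleton m)
    obtain ⟨U, hU, hUe⟩ := isGδ_iff_eq_iInter_nat.1 (hX.isGδ_of_measurableSet hm.compl)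
    refine ⟨fun j => (U j)ᶜ, fun j => (hU j).isClosed_compl, ?_⟩
    rw [← compl_iInter, ← hUe, compl_compl]
  choose D hD hDe using hA
  obtain ⟨β, hβ⟩ := hX.exists_closed_selection
    -- These closed sets increase to the whole space with `k`, and `f x n ≤ k` on the `k`-th one.
    (fun n k => ⋃ m ∈ Finset.range (k + 1), ⋃ j ∈ Finset.range (k + 1), D n m j)
    (fun n k => isClosed_biUnion_finset fun m _ => isClosed_biUnion_finset fun j _ => hD n m j)
    (fun n x => by
      have hx : x ∈ {y | f y n = f x n} := rfl
      rw [hDe] at hx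
      obtain ⟨j, hj⟩ := mem_iUnion.1 hx
      filter_upwards [eventually_ge_atTop (max (f x n) j)] with k hk
      exact mem_biUnion (Finset.mem_coe.2 (Finset.mem_range.2 (by omega)))
        (mem_biUnion (Finset.mem_coe.2 (Finset.mem_range.2 (by omega))) hj))
  refine ⟨β, ?_⟩
  rintro _ ⟨x, rfl⟩
  filter_upwards [hβ x] with n hn
  obtain ⟨m, hm, hn⟩ := mem_iUnion₂.1 hn
  obtain ⟨j, -, hj⟩ := mem_iUnion₂.1 hn
  have : x ∈ {y | f y n = m} := by
    rw [hDe]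
    exact mem_iUnion.2 ⟨j, hj⟩
  change f x n = m at this
  rw [this]
  exact Nat.lt_succ_iff.1 (Finset.mem_range.1 hm)

end QN

/-! ### Consequences and reductions of bounded Borel images -/

section Bounded

variable [MeasurableSpace X]

/-- If all measurable images in `ℕ → ℕ` are eventually bounded, then countably many pointwise
eventual measurable conditions hold on simultaneous tails. -/
theorem exists_tails_of_eventuallyBounded
    (h : ∀ f : X → ℕ → ℕ, Measurable f → EventuallyBounded (range f))
    (D : ℕ → ℕ → Set X) (hD : ∀ n k, MeasurableSet (D n k))
    (hcov : ∀ n x, ∀ᶠ k in atTop, x ∈ D n k) :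
    ∃ β : ℕ → ℕ, ∀ x, ∀ᶠ n in atTop, ∀ k, β n ≤ k → x ∈ D n k := by
  classical
  have hex : ∀ x n, ∃ k, ∀ j, k ≤ j → x ∈ D n j := fun x n => eventually_atTop.1 (hcov n x)
  have hiff : ∀ x n k, Nat.find (hex x n) ≤ k ↔ ∀ j, k ≤ j → x ∈ D n j := by
    intro x n k
    refine ⟨fun hk j hj => Nat.find_spec (hex x n) j (hk.trans hj), fun hk => Nat.find_min' _ hk⟩
  obtain ⟨β, hβ⟩ := h (fun x n => Nat.find (hex x n)) (by
    refine measurable_pi_lambda _ fun n => measurable_of_Iic fun k => ?_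
    -- The modulus is measurable because its sublevel sets are countable intersections.
    have : (fun x => Nat.find (hex x n)) ⁻¹' Iic k = ⋂ j, ⋂ (_ : k ≤ j), D n j := by
      ext x
      simp only [mem_preimage, mem_Iic, hiff, mem_iInter]
    rw [this]
    exact MeasurableSet.iInter fun j => MeasurableSet.iInter fun _ => hD n j)
  refine ⟨β, fun x => ?_⟩
  filter_upwards [hβ _ ⟨x, rfl⟩] with n hn
  exact (hiff x n _).1 hn

theorem isQNSpace_of_eventuallyBounded [TopologicalSpace X] [OpensMeasurableSpace X]
    (h : ∀ f : X → ℕ → ℕ, Measurable f → EventuallyBounded (range f)) : IsQNSpace X := by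
  classical
  intro f hf ht
  obtain ⟨β, hβ⟩ := exists_tails_of_eventuallyBounded h
    (fun n j => {x | |f j x| < 1 / ((n : ℝ) + 1)})
    (fun n j => measurableSet_lt (hf j).abs.measurable measurable_const)
    (fun n x => by
      have hpos : (0 : ℝ) < 1 / ((n : ℝ) + 1) := by positivity
      simpa [Real.dist_eq] using Metric.tendsto_nhds.1 (ht x) _ hpos)
  -- `N j` is the finest accuracy level already secured at stage `j`, and the control sequence is `1
  -- / (N j + 1)`. The summand `n` keeps qualifying levels within the search bound `j`.
  set N : ℕ → ℕ := fun j => Nat.findGreatest (fun n => β n + n ≤ j) j with hN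
  have hNge : ∀ n j, β n + n ≤ j → n ≤ N j ∧ β (N j) + N j ≤ j := fun n j hj =>
    ⟨Nat.le_findGreatest (by omega) hj,
      Nat.findGreatest_spec (P := fun n => β n + n ≤ j) (m := n) (by omega) hj⟩
  refine ⟨fun j => 1 / ((N j : ℝ) + 1), fun j => by positivity, ?_, fun x => ?_⟩
  · refine tendsto_one_div_add_atTop_nhds_zero_nat.comp (tendsto_atTop.2 fun n => ?_)
    filter_upwards [eventually_ge_atTop (β n + n)] with j hj
    exact (hNge n j hj).1
  · obtain ⟨M, hM⟩ := eventually_atTop.1 (hβ x)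
    filter_upwards [eventually_ge_atTop (β M + M)] with j hj
    obtain ⟨h1, h2⟩ := hNge M j hj
    rw [sub_zero]
    exact hM (N j) h1 j (by omega)

theorem eventuallyBounded_real_iff_nat :
    (∀ f : X → ℕ → ℝ, Measurable f → EventuallyBounded (range f)) ↔
      ∀ f : X → ℕ → ℕ, Measurable f → EventuallyBounded (range f) := by
  constructor
  · intro h f hf
    obtain ⟨β, hβ⟩ := h (fun x n => (f x n : ℝ)) (measurable_pi_lambda _ fun n =>
      measurable_from_top.comp ((measurable_pi_apply n).comp hf))
    refine ⟨fun n => ⌈β n⌉₊, ?_⟩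
    rintro _ ⟨x, rfl⟩
    filter_upwards [hβ _ ⟨x, rfl⟩] with n hn
    exact_mod_cast hn.trans (Nat.le_ceil (β n))
  · intro h f hf
    obtain ⟨β, hβ⟩ := h (fun x n => ⌈f x n⌉₊) (measurable_pi_lambda _ fun n =>
      ((measurable_pi_apply n).comp hf).nat_ceil)
    refine ⟨fun n => β n, ?_⟩
    rintro _ ⟨x, rfl⟩
    filter_upwards [hβ _ ⟨x, rfl⟩] with n hn
    exact (Nat.le_ceil _).trans (by exact_mod_cast hn)

/-- To bound measurable images it suffices to treat monotone sequences, and to bound these on an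
infinite set of indices. -/
theorem eventuallyBounded_of_monotone
    (h : ∀ f : X → ℕ → ℕ, Measurable f → (∀ x, Monotone (f x)) →
      ∃ (β : ℕ → ℕ) (A : Set ℕ), A.Infinite ∧ ∀ x, {n ∈ A | β n < f x n}.Finite)
    (f : X → ℕ → ℕ) (hf : Measurable f) : EventuallyBounded (range f) := by
  obtain ⟨β, A, hA, hβ⟩ := h (fun x n => ∑ i ∈ Finset.range (n + 1), f x i)
    (measurable_pi_lambda _ fun n => Finset.measurable_sum _ fun i _ =>
      (measurable_pi_apply i).comp hf)
    (fun x m n hmn => Finset.sum_le_sum_of_subset (Finset.range_mono (by omega)))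
  -- The next index `a n > n` in `A` bounds a partial sum that contains the term `f x n`.
  choose a haA ha using fun n : ℕ => hA.exists_gt n
  refine ⟨fun n => β (a n), ?_⟩
  rintro _ ⟨x, rfl⟩
  obtain ⟨M, hM⟩ := (hβ x).bddAbove
  filter_upwards [eventually_ge_atTop M] with n hn
  have hle : ∑ i ∈ Finset.range (a n + 1), f x i ≤ β (a n) := by
    by_contra hlt
    have := hM ⟨haA n, not_le.1 hlt⟩
    have := ha n
    omega
  have hna := ha n
  exact (Finset.single_le_sum (f := f x) (fun _ _ => Nat.zero_le _)
    (Finset.mem_range.2 (by omega))).trans hle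

end Bounded

/-! ### Passing between sequences and their ranges -/

section Sequences

variable {Y : Type*}

/-- Keep one index for each value: `u` is injective on `A`, so finiteness among values becomes
finiteness among indices. -/
theorem exists_infinite_finite_fibers {u : ℕ → Y} (hu : (range u).Infinite) :
    ∃ A : Set ℕ, A.Infinite ∧ ∀ P : Y → Prop, {y ∈ range u | P y}.Finite →
      {n ∈ A | P (u n)}.Finite := by
  obtain ⟨A, hAu, hinj⟩ := Set.exists_image_eq_and_injOn univ u
  rw [image_univ] at hAu
  refine ⟨A, fun hfin => hu (hAu ▸ hfin.image u), fun P hP => ?_⟩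
  refine Set.Finite.of_finite_image (hP.subset ?_) (hinj.mono (sep_subset _ _))
  rintro _ ⟨n, ⟨-, hn⟩, rfl⟩
  exact ⟨mem_range_self n, hn⟩

theorem exists_index_bound {g : ℕ → Y} {V : Set Y} (hV : V.Finite) (hVg : V ⊆ range g) :
    ∃ b, ∀ v ∈ V, ∃ k ≤ b, g k = v := by
  choose! c hc using fun v (hv : v ∈ V) => hVg hv
  obtain ⟨b, hb⟩ := (hV.image c).bddAbove
  exact ⟨b, fun v hv => ⟨c v, hb (mem_image_of_mem c hv), hc v hv⟩⟩

/-- Were the range finite, some value would recur infinitely often. -/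
theorem infinite_range_of_eventually_ne {u : ℕ → Y} (h : ∀ n, ∀ᶠ m in atTop, u m ≠ u n) :
    (range u).Infinite := by
  intro hfin
  obtain ⟨y, ⟨n, rfl⟩, hn⟩ : ∃ y ∈ range u, ∃ᶠ m in atTop, u m = y := by
    by_contra! hcon
    have h2 : ∀ᶠ m in atTop, ∀ y ∈ range u, u m ≠ y :=
      (Filter.eventually_all_finite hfin).2 fun y hy => hcon y hy
    obtain ⟨m, hm⟩ := h2.exists
    exact hm _ (mem_range_self m) rfl
  exact hn (h n)

theorem finite_sep_range {u : ℕ → Y} {P : Y → Prop} (h : ∀ᶠ n in atTop, ¬ P (u n)) :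
    {y ∈ range u | P y}.Finite := by
  rw [← Nat.cofinite_eq_atTop] at h
  have hfin : {n | P (u n)}.Finite := by simpa [Filter.eventually_cofinite] using h
  refine (hfin.image u).subset ?_
  rintro _ ⟨⟨n, rfl⟩, hn⟩
  exact mem_image_of_mem u hn

theorem eventually_not_of_finite {F : Set Y} {e : ℕ → Y} (he : Function.Injective e)
    (heF : ∀ k, e k ∈ F) {P : Y → Prop} (h : {y ∈ F | P y}.Finite) :
    ∀ᶠ k in atTop, ¬ P (e k) := by
  rw [← Nat.cofinite_eq_atTop, Filter.eventually_cofinite]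
  refine (h.preimage he.injOn).subset fun k hk => ⟨heF k, ?_⟩
  simpa using hk

end Sequences

/-! ### The two selection principles -/

section Principles

theorem minFun_singleton (f : X → ℝ) : minFun {f} = f := by
  ext x
  simp [minFun]

variable [MeasurableSpace X]

/-- Singletons suffice: enumerate part of each `F n` and pick a member so late that at each point
the `n`-th choice is eventually below `1 / (n + 1)`. The choices tend pointwise to 0 and none is
zero, so none recurs infinitely often. -/
theorem ufinStar_of_eventuallyBounded
    (h : ∀ f : X → ℕ → ℕ, Measurable f → EventuallyBounded (range f)) :
    UfinStar (gammaZero {f : X → ℝ | Measurable f}) (gammaZero {f : X → ℝ | Measurable f}) := by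
  intro F hF
  let e : ∀ n, ℕ ↪ F n := fun n => (hF n).2.2.1.natEmbedding
  have he : ∀ n, Function.Injective fun k => (e n k : X → ℝ) := fun n =>
    Subtype.val_injective.comp (e n).injective
  obtain ⟨β, hβ⟩ := exists_tails_of_eventuallyBounded h
    (fun n k => {x | |(e n k : X → ℝ) x| < 1 / ((n : ℝ) + 1)})
    (fun n k => by
      have hm : Measurable (e n k : X → ℝ) := (hF n).1 (e n k).2
      have : Measurable fun x => |(e n k : X → ℝ) x| := hm.abs
      exact measurableSet_lt this measurable_const)
    (fun n x => by
      have := eventually_not_of_finite (he n) (fun k => (e n k).2)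
        ((hF n).2.2.2 x (1 / ((n : ℝ) + 1)) (by positivity))
      simpa only [not_le, mem_ofPred_eq] using this)
  set u : ℕ → X → ℝ := fun n => e n (β n) with hu
  have hsmall : ∀ x, ∀ ε : ℝ, 0 < ε → ∀ᶠ n in atTop, ¬ ε ≤ |u n x| := by
    intro x ε hε
    filter_upwards [hβ x, tendsto_one_div_add_atTop_nhds_zero_nat.eventually_lt_const hε]
      with n hn hn'
    exact not_le.2 ((hn _ le_rfl).trans hn')
  have h0 : ∀ n, u n ≠ 0 := fun n h0 => (hF n).2.1 (h0 ▸ (e n (β n)).2)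
  refine ⟨fun n => {u n}, fun n => by simp [hu], ?_⟩
  simp only [minFun_singleton]
  refine ⟨?_, ?_, ?_, fun x ε hε => finite_sep_range (hsmall x ε hε)⟩
  · rintro _ ⟨n, rfl⟩
    exact (hF n).1 (e n (β n)).2
  · rintro ⟨n, hn⟩
    exact h0 n hn
  · refine infinite_range_of_eventually_ne fun n => ?_
    obtain ⟨x, hx⟩ := Function.ne_iff.1 (h0 n)
    filter_upwards [hsmall x |u n x| (abs_pos.2 hx)] with m hm hmn
    exact hm (by rw [hmn])

theorem ufin_of_eventuallyBounded
    (h : ∀ f : X → ℕ → ℕ, Measurable f → EventuallyBounded (range f)) :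
    Ufin (gammaCovers {s : Set X | MeasurableSet s})
      (gammaCovers {s : Set X | MeasurableSet s}) := by
  intro 𝒰 h𝒰
  let e : ∀ n, ℕ ↪ 𝒰 n := fun n => (h𝒰 n).1.2.1.natEmbedding
  have he : ∀ n, Function.Injective fun k => (e n k : Set X) := fun n =>
    Subtype.val_injective.comp (e n).injective
  obtain ⟨β, hβ⟩ := exists_tails_of_eventuallyBounded h (fun n k => (e n k : Set X))
    (fun n k => (h𝒰 n).2 (e n k).2)
    (fun n x => by
      have := eventually_not_of_finite (he n) (fun k => (e n k).2) ((h𝒰 n).1.2.2 x)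
      simpa only [not_not] using this)
  set u : ℕ → Set X := fun n => e n (β n) with hu
  have hmem : ∀ x, ∀ᶠ n in atTop, x ∈ u n := fun x => (hβ x).mono fun n hn => hn _ le_rfl
  have huniv : ∀ n, u n ≠ univ := fun n hn => (h𝒰 n).1.1.2 (hn ▸ (e n (β n)).2)
  refine ⟨fun n => {u n}, fun n => ⟨finite_singleton _, by simp [hu]⟩, Or.inl ?_⟩
  simp only [sUnion_singleton]
  refine ⟨⟨⟨?_, ?_⟩, ?_, fun x => ?_⟩, ?_⟩
  · refine eq_univ_of_forall fun x => ?_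
    obtain ⟨n, hn⟩ := (hmem x).exists
    exact ⟨u n, mem_range_self n, hn⟩
  · rintro ⟨n, hn⟩
    exact huniv n hn
  · refine infinite_range_of_eventually_ne fun n => ?_
    obtain ⟨x, hx⟩ := (ne_univ_iff_exists_notMem _).1 (huniv n)
    filter_upwards [hmem x] with m hm hmn
    exact hx (hmn ▸ hm)
  · refine finite_sep_range ?_
    simpa only [not_not] using hmem x
  · rintro _ ⟨n, rfl⟩
    exact (h𝒰 n).2 (e n (β n)).2

theorem eventuallyBounded_of_ufinStar
    (h : UfinStar (gammaZero {f : X → ℝ | Measurable f}) (gammaZero {f : X → ℝ | Measurable f}))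
    (f : X → ℕ → ℕ) (hf : Measurable f) : EventuallyBounded (range f) := by
  rcases isEmpty_or_nonempty X with hX | ⟨⟨x₀⟩⟩
  · exact ⟨0, by rintro _ ⟨x, rfl⟩; exact hX.elim x⟩
  refine eventuallyBounded_of_monotone (fun f hf _ => ?_) f hf
  -- The indicator records whether `k` fails to bound `f x n`; the positive summand keeps the
  -- functions nonzero and makes infinitely many of them distinct.
  let g : ℕ → ℕ → X → ℝ := fun n k x => 1 / ((k : ℝ) + 1) + if k < f x n then 1 else 0
  have hgpos : ∀ n k x, 0 < g n k x := fun n k x => by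
    have : (0 : ℝ) < 1 / ((k : ℝ) + 1) := by positivity
    simp only [g]
    split_ifs <;> linarith
  have hgm : ∀ n k, Measurable (g n k) := fun n k =>
    measurable_const.add (Measurable.ite
      (measurableSet_lt measurable_const ((measurable_pi_apply n).comp hf))
      measurable_const measurable_const)
  have hgt : ∀ n x, Tendsto (fun k => g n k x) atTop (𝓝 0) := fun n x => by
    refine tendsto_one_div_add_atTop_nhds_zero_nat.congr' ?_
    filter_upwards [eventually_ge_atTop (f x n)] with k hk
    simp [g, not_lt.2 hk]
  obtain ⟨H, hHF, -, -, hinf, hfin⟩ := h (fun n => range (g n)) fun n => by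
    refine ⟨?_, ?_, ?_, fun x ε hε => finite_sep_range ?_⟩
    · rintro _ ⟨k, rfl⟩
      exact hgm n k
    · rintro ⟨k, hk⟩
      exact (hgpos n k x₀).ne' (congrFun hk x₀)
    · refine infinite_range_of_eventually_ne fun k => ?_
      filter_upwards [(hgt n x₀).eventually_lt_const (hgpos n k x₀)] with m hm hmk
      rw [hmk] at hm
      exact lt_irrefl _ hm
    · filter_upwards [(hgt n x).eventually_lt_const hε] with k hk
      rw [abs_of_pos (hgpos n k x)]
      exact not_le.2 hk
  choose β hβ using fun n => exists_index_bound (H n).finite_toSet (hHF n)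
  obtain ⟨A, hA, hAP⟩ := exists_infinite_finite_fibers hinf
  -- If `β n < f x n`, every selected function is at least 1 at `x`, hence so is the minimum. An
  -- empty selection agrees with this because `min ∅ = 1`.
  refine ⟨β, A, hA, fun x => (hAP _ (hfin x 1 one_pos)).subset ?_⟩
  rintro n ⟨hnA, hn⟩
  refine ⟨hnA, le_trans ?_ (le_abs_self _)⟩
  unfold minFun
  split_ifs with hne
  · refine Finset.le_inf' _ _ fun v hv => ?_
    obtain ⟨k, hk, rfl⟩ := hβ n v hv
    have : (0 : ℝ) < 1 / ((k : ℝ) + 1) := by positivity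
    simp only [g, if_pos (hk.trans_lt hn)]
    linarith
  · exact le_rfl

theorem eventuallyBounded_of_ufin
    (h : Ufin (gammaCovers {s : Set X | MeasurableSet s})
      (gammaCovers {s : Set X | MeasurableSet s}))
    (f : X → ℕ → ℕ) (hf : Measurable f) : EventuallyBounded (range f) := by
  rcases isEmpty_or_nonempty X with hX | ⟨⟨x₀⟩⟩
  · exact ⟨0, by rintro _ ⟨x, rfl⟩; exact hX.elim x⟩
  refine eventuallyBounded_of_monotone (fun f hf _ => ?_) f hf
  -- Infinitely many bounded coordinates already give the required index set. Otherwise all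
  -- coordinates beyond some `N` are unbounded, so their sublevel sets are proper and form γ-covers.
  by_cases hB : {n | ∃ b, ∀ x, f x n ≤ b}.Infinite
  · have hb : ∀ n ∈ {n | ∃ b, ∀ x, f x n ≤ b}, ∃ b, ∀ x, f x n ≤ b := fun n hn => hn
    choose! b hb using hb
    refine ⟨b, _, hB, fun x => finite_empty.subset ?_⟩
    rintro n ⟨hnA, hn⟩
    exact (hb n hnA x).not_gt hn
  obtain ⟨N, hN⟩ := (not_infinite.1 hB).bddAbove
  have hunb : ∀ n b, ∃ x, b < f x (n + (N + 1)) := by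
    intro n b
    by_contra! hcon
    have : n + (N + 1) ≤ N := hN ⟨b, hcon⟩
    omega
  let g : ℕ → ℕ → Set X := fun n k => {x | f x (n + (N + 1)) ≤ k}
  have hgev : ∀ n x, ∀ᶠ k in atTop, x ∈ g n k := fun n x => eventually_ge_atTop _
  have hgu : ∀ n k, g n k ≠ univ := fun n k hk => by
    obtain ⟨x, hx⟩ := hunb n k
    have : x ∈ g n k := hk ▸ mem_univ x
    exact hx.not_ge this
  obtain ⟨V, hV, hVu⟩ := h (fun n => range (g n)) fun n => by
    refine ⟨⟨⟨?_, ?_⟩, ?_, fun x => finite_sep_range ?_⟩, ?_⟩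
    · refine eq_univ_of_forall fun x => ?_
      obtain ⟨k, hk⟩ := (hgev n x).exists
      exact ⟨g n k, mem_range_self k, hk⟩
    · rintro ⟨k, hk⟩
      exact hgu n k hk
    · refine infinite_range_of_eventually_ne fun k => ?_
      obtain ⟨x, hx⟩ := (ne_univ_iff_exists_notMem _).1 (hgu n k)
      filter_upwards [hgev n x] with m hm hmk
      exact hx (hmk ▸ hm)
    · simpa only [not_not] using hgev n x
    · rintro _ ⟨k, rfl⟩
      exact measurableSet_le ((measurable_pi_apply _).comp hf) measurable_const
  choose β hβ using fun n => exists_index_bound (hV n).1 (hV n).2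
  have hsub : ∀ n, ⋃₀ V n ⊆ g n (β n) := by
    rintro n x ⟨v, hv, hx⟩
    obtain ⟨k, hk, rfl⟩ := hβ n v hv
    exact le_trans (show f x (n + (N + 1)) ≤ k from hx) hk
  rcases hVu with ⟨⟨-, hinf, hfin⟩, -⟩ | ⟨n, hn⟩
  · obtain ⟨A, hA, hAP⟩ := exists_infinite_finite_fibers hinf
    -- The covers were built from coordinates shifted by `N + 1`, so the index set is shifted and
    -- the bound shifted back.
    refine ⟨fun n => β (n - (N + 1)), (fun n => n + (N + 1)) '' A,
      hA.image (add_left_injective _).injOn, fun x =>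
        ((hAP _ (hfin x)).image (fun n => n + (N + 1))).subset ?_⟩
    rintro _ ⟨⟨n, hnA, rfl⟩, hn⟩
    refine ⟨n, ⟨hnA, fun hx => ?_⟩, rfl⟩
    simp only [Nat.add_sub_cancel] at hn
    exact (show f x (n + (N + 1)) ≤ β n from hsub n hx).not_gt hn
  -- A finite union of sublevel sets lies in a single proper one, so it cannot be the whole space.
  · exact (hgu n (β n) (univ_subset_iff.1 (hn ▸ hsub n))).elim

end Principles

end SelectionPrinciples

theorem mainTheorem9 {X : Type*} [TopologicalSpace X] [T6Space X]
    [MeasurableSpace X] [BorelSpace X] :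
    List.TFAE [
      SelectionPrinciples.IsQNSpace X,
      ∀ f : X → ℕ → ℝ, Measurable f → SelectionPrinciples.EventuallyBounded (Set.range f),
      ∀ f : X → ℕ → ℕ, Measurable f → SelectionPrinciples.EventuallyBounded (Set.range f),
      SelectionPrinciples.UfinStar
        (SelectionPrinciples.gammaZero {f : X → ℝ | Measurable f})
        (SelectionPrinciples.gammaZero {f : X → ℝ | Measurable f}),
      SelectionPrinciples.Ufin
        (SelectionPrinciples.gammaCovers {s : Set X | MeasurableSet s})
        (SelectionPrinciples.gammaCovers {s : Set X | MeasurableSet s})] := by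
  tfae_have 1 → 3 := fun h f hf => h.eventuallyBounded f hf
  tfae_have 3 → 1 := SelectionPrinciples.isQNSpace_of_eventuallyBounded
  tfae_have 2 ↔ 3 := SelectionPrinciples.eventuallyBounded_real_iff_nat
  tfae_have 3 → 4 := SelectionPrinciples.ufinStar_of_eventuallyBounded
  tfae_have 4 → 3 := SelectionPrinciples.eventuallyBounded_of_ufinStar
  tfae_have 3 → 5 := SelectionPrinciples.ufin_of_eventuallyBounded
  tfae_have 5 → 3 := SelectionPrinciples.eventuallyBounded_of_ufin
  tfae_finish
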